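/- For $n\ge 1$, let $\mathcal{B}_n(\mathbb{Z})$ be the simplicial complex whose simplices are the nonempty finite sets $\{u_1,\dots,u_k\}\subset\mathbb{Z}^n$ that are contained in some basis of the free abelian group $\mathbb{Z}^n$. Let $\Gamma_n[2]$ be the kernel of the reduction map $\mathrm{GL}(n,\mathbb{Z})\to\mathrm{GL}(n,\mathbb{Z}/2)$, let $v_1,\dots,v_n$ be the standard basis of $\mathbb{Z}^n$, and call a set of the form $\{Mv_1,\dots,Mv_n\}$ with $M\in\Gamma_n[2]$ a $\pi$-basis of $\mathbb{Z}^n$. Let $\mathcal{B}^\pi_n(\mathbb{Z})$ be the subcomplex of $\mathcal{B}_n(\mathbb{Z})$ whose simplices are the nonempty subsets of $\pi$-bases. Let $\mathcal{Y}$ (the augmented partial $\pi$-basis complex for $\mathbb{Z}^3$) be the full subcomplex of $\mathcal{B}_3(\mathbb{Z})$ spanned by the vertices of $\mathcal{B}^\pi_3(\mathbb{Z})$ together with all vertices $u=(u^{(1)},u^{(2)},u^{(3)})$ of $\mathcal{B}_3(\mathbb{Z})$ for which $u^{(1)}$ and $u^{(2)}$ are odd and $u^{(3)}$ is even. **Theorem.**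 The complex $\mathcal{Y}$ is simply connected; that is, its geometric realization (with the weak topology) is path-connected and has trivial fundamental group. -/

import Mathlib

namespace PreAbstractSimplicialComplex

variable {ι : Type*}

/-- The vertices of a simplicial complex: the points that span a face. -/
def vertexSet (K : PreAbstractSimplicialComplex ι) : Set ι :=
  {v | {v} ∈ K.faces}

/-- The full subcomplex of `K` spanned by a set `V`: all faces of `K` whose vertices lie in `V`. -/
def fullSubcomplex (K : PreAbstractSimplicialComplex ι) (V : Set ι) :
    PreAbstractSimplicialComplex ι where
  faces := {s | s ∈ K.faces ∧ (s : Set ι) ⊆ V}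
  isRelLowerSet_faces := fun _ hs =>
    ⟨(K.isRelLowerSet_faces hs.1).1, fun _ hts ht =>
      ⟨(K.isRelLowerSet_faces hs.1).2 hts ht, (Finset.coe_subset.2 hts).trans hs.2⟩⟩

/-- The closed geometric simplex on a finite vertex set `s`, in barycentric coordinates, with the
topology of a subspace of `ι → ℝ` (only the finitely many coordinates in `s` can be nonzero, so
this is the usual Euclidean simplex). -/
def closedSimplex (s : Finset ι) : Set (ι → ℝ) :=
  {x | (∀ i, 0 ≤ x i) ∧ (∀ i, i ∉ s → x i = 0) ∧ ∑ i ∈ s, x i = 1}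

/-- The geometric realization of a simplicial complex: the union of the closed simplices on its
faces. It is a type of its own, so that it does not carry the subspace topology of `ι → ℝ`. -/
def Realization (K : PreAbstractSimplicialComplex ι) : Type _ :=
  {x : ι → ℝ // ∃ s ∈ K.faces, x ∈ closedSimplex s}

/-- The inclusion of a closed simplex into the realization. -/
def faceInclusion (K : PreAbstractSimplicialComplex ι) (s : K.faces) :
    closedSimplex (s : Finset ι) → K.Realization :=
  fun x => ⟨x.1, s.1, s.2, x.2⟩

/-- The weak topology on the realization: a set is open if and only if its preimage in each
closed simplex is open. -/
instance instTopologicalSpaceRealization (K : PreAbstractSimplicialComplex ι) :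
    TopologicalSpace K.Realization :=
  ⨆ s : K.faces, TopologicalSpace.coinduced (K.faceInclusion s) inferInstance

end PreAbstractSimplicialComplex

namespace PalindromicComplex

/-- The complex `ℬₙ(ℤ)` of partial bases of `ℤⁿ`: its simplices are the nonempty finite subsets of
bases of the free abelian group `ℤⁿ`. -/
def partialBasisComplex (n : ℕ) : PreAbstractSimplicialComplex (Fin n → ℤ) where
  faces := {s | s.Nonempty ∧
    ∃ b : Module.Basis (Fin n) ℤ (Fin n → ℤ), (s : Set (Fin n → ℤ)) ⊆ Set.range b}
  isRelLowerSet_faces := fun _ hs =>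
    ⟨hs.1, fun _ hts ht =>
      ⟨ht, hs.2.imp fun _ hb => (Finset.coe_subset.2 hts).trans hb⟩⟩

/-- The principal level 2 congruence subgroup `Γₙ[2]` of `GL(n, ℤ)`. -/
def levelTwo (n : ℕ) : Subgroup (Matrix.GeneralLinearGroup (Fin n) ℤ) :=
  (Matrix.GeneralLinearGroup.map (n := Fin n) (Int.castRingHom (ZMod 2))).ker

/-- A `π`-basis of `ℤⁿ` is a set of the form `{M v₁, …, M vₙ}` with `M ∈ Γₙ[2]`, where
`v₁, …, vₙ` is the standard basis. -/
def IsPiBasis {n : ℕ} (B : Set (Fin n → ℤ)) : Prop :=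
  ∃ M ∈ levelTwo n,
    B = Set.range fun j : Fin n => (M : Matrix (Fin n) (Fin n) ℤ).mulVec (Pi.single j 1)

/-- The complex of partial `π`-bases of `ℤⁿ`: its simplices are the nonempty finite subsets of
`π`-bases. -/
def partialPiBasisComplex (n : ℕ) : PreAbstractSimplicialComplex (Fin n → ℤ) where
  faces := {s | s.Nonempty ∧ ∃ B : Set (Fin n → ℤ), IsPiBasis B ∧ (s : Set (Fin n → ℤ)) ⊆ B}
  isRelLowerSet_faces := fun _ hs =>
    ⟨hs.1, fun _ hts ht =>
      ⟨ht, hs.2.imp fun _ hB => ⟨hB.1, (Finset.coe_subset.2 hts).trans hB.2⟩⟩⟩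

/-- The augmented partial `π`-basis complex `𝒴` for `ℤ³`: the full subcomplex of `ℬ₃(ℤ)` spanned by
the vertices of the complex of partial `π`-bases and the vertices `u` of `ℬ₃(ℤ)` whose first two
coordinates are odd and whose third coordinate is even. -/
def augmentedComplex : PreAbstractSimplicialComplex (Fin 3 → ℤ) :=
  (partialBasisComplex 3).fullSubcomplex
    ((partialPiBasisComplex 3).vertexSet ∪
      {u | u ∈ (partialBasisComplex 3).vertexSet ∧ Odd (u 0) ∧ Odd (u 1) ∧ Even (u 2)})

end PalindromicComplex

/-!
A complex is simply connected as soon as its vertices can be joined to a base vertex by homotopy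
classes of paths that are compatible with the edges: any path is cut into pieces lying in open
stars, and two paths with the same ends and with ranges in one open star are homotopic, since by
compactness they meet only finitely many open simplices.

For `𝒴` such a choice is made by induction on the height `|u⁽³⁾|`. Below the height of `v` the
choice is already compatible with the edges, so that the class obtained for `v` does not depend on
the lower neighbour through which it is reached if the lower neighbours form a connected graph, two
being adjacent when they span a triangle with `v`. An edge with ends of equal positive height lies
in a triangle with a lower vertex, and the part of height `0` is a cone with apex `e₃`.

Completing `v` to a basis `v, y, z`, a neighbour `u` of `v` has coordinates `αv + ay + bz` with `a`
and `b` coprime, and the graph is connected by a Euclidean descent on `|b|` along Farey neighbours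
of `(a, b)`. Parity enters through the fact that `cy + dz` is congruent to `y` or to `z` modulo `2`
if `c + d` is odd, and each such vector is pushed below the height of `v` by adding a multiple
of `v`.
-/

open scoped unitInterval

section OpenCover

open Path.Homotopic.Quotient

variable {X κ : Type*} [TopologicalSpace X] {x₀ : X} {U : κ → Set X}

theorem trans_mk_eq_of_openCover (hUo : ∀ i, IsOpen (U i)) (hU : ⋃ i, U i = Set.univ)
    (T : ∀ a, Path.Homotopic.Quotient x₀ a)
    (hT : ∀ i {a b : X} (γ : Path a b), Set.range γ ⊆ U i → (T a).trans (mk γ) = T b)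
    {a b : X} (γ : Path a b) : (T a).trans (mk γ) = T b := by
  obtain ⟨t, ht0, hmono, ⟨n, hn⟩, hcover⟩ := exists_monotone_Icc_subset_open_cover_unitInterval
    (fun i => (hUo i).preimage γ.continuous)
    (by rw [← Set.preimage_iUnion, hU, Set.preimage_univ])
  have initial_segment (k : ℕ) : (T (γ 0)).trans (mk (γ.subpath 0 (t k))) = T (γ (t k)) := by
    induction k with
    | zero => rw [ht0, Path.subpath_self, mk_refl, trans_refl]
    | succ k ih =>
      obtain ⟨i, hi⟩ := hcover k
      have hstep := hT i (γ.subpath (t k) (t (k + 1))) (by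
        rw [Path.range_subpath_of_le _ _ _ (hmono k.le_succ)]
        exact Set.image_subset_iff.2 hi)
      have hsplit : mk (γ.subpath 0 (t (k + 1))) =
          (mk (γ.subpath 0 (t k))).trans (mk (γ.subpath (t k) (t (k + 1)))) := by
        rw [← mk_trans, eq]
        exact ⟨(Path.Homotopy.subpathTransSubpath γ 0 (t k) (t (k + 1))).symm⟩
      rw [hsplit, ← trans_assoc, ih, hstep]
  have whole := initial_segment n
  rw [hn n le_rfl, Path.subpath_zero_one] at whole
  have transport {a' b' : X} (ha : a' = a) (hb : b' = b)
      (h : (T a').trans (mk (γ.cast ha hb)) = T b') : (T a).trans (mk γ) = T b := by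
    subst ha hb
    exact h
  exact transport γ.source γ.target whole

theorem simplyConnectedSpace_of_openCover (hUo : ∀ i, IsOpen (U i)) (hU : ⋃ i, U i = Set.univ)
    (T : ∀ a, Path.Homotopic.Quotient x₀ a)
    (hT : ∀ i {a b : X} (γ : Path a b), Set.range γ ⊆ U i → (T a).trans (mk γ) = T b) :
    SimplyConnectedSpace X := by
  rw [simply_connected_iff_paths_homotopic']
  have joined (a : X) : Joined x₀ a := ⟨(T a).out⟩
  refine ⟨⟨⟨x₀⟩, fun a b => (joined a).symm.trans (joined b)⟩, fun {a b} γ γ' => ?_⟩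
  rw [← eq]
  have h : (T a).trans (mk γ) = (T a).trans (mk γ') := by
    rw [trans_mk_eq_of_openCover hUo hU T hT, trans_mk_eq_of_openCover hUo hU T hT]
  simpa only [← trans_assoc, symm_trans, refl_trans] using congrArg (T a).symm.trans h

end OpenCover

namespace SimplicialRealization

open PreAbstractSimplicialComplex

variable {ι : Type*} {s t : Finset ι} {v : ι}

theorem isClosed_closedSimplex (s : Finset ι) : IsClosed (closedSimplex s) := by
  simp only [closedSimplex, Set.ofPred_and, Set.ofPred_forall]
  refine .inter ?_ (.inter ?_ ?_)
  · exact isClosed_iInter fun i => isClosed_le continuous_const (continuous_apply i)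
  · exact isClosed_iInter fun i => isClosed_iInter fun _ =>
      isClosed_eq (continuous_apply i) continuous_const
  · exact isClosed_eq (continuous_finsetSum _ fun i _ => continuous_apply i) continuous_const

theorem convex_closedSimplex (s : Finset ι) : Convex ℝ (closedSimplex s) := by
  rintro x ⟨hx0, hx, hx1⟩ y ⟨hy0, hy, hy1⟩ a b ha hb hab
  refine ⟨fun i => ?_, fun i hi => ?_, ?_⟩
  · exact add_nonneg (mul_nonneg ha (hx0 i)) (mul_nonneg hb (hy0 i))
  · simp [hx i hi, hy i hi]
  · simp only [Pi.add_apply, Pi.smul_apply, smul_eq_mul, Finset.sum_add_distrib, ← Finset.mul_sum,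
      hx1, hy1, mul_one, hab]

theorem closedSimplex_mono (h : s ⊆ t) : closedSimplex s ⊆ closedSimplex t :=
  fun _ hx => ⟨hx.1, fun i hi => hx.2.1 i (mt (@h i) hi), by
    rw [← Finset.sum_subset h fun i _ => hx.2.1 i, hx.2.2]⟩

theorem single_mem_closedSimplex [DecidableEq ι] (hv : v ∈ s) :
    (Pi.single v 1 : ι → ℝ) ∈ closedSimplex s := by
  refine ⟨fun i => ?_, fun i hi => ?_, ?_⟩
  · rw [Pi.single_apply]
    positivity
  · exact Pi.single_eq_of_ne (ne_of_mem_of_not_mem hv hi).symm 1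
  · rw [Finset.sum_pi_single', if_pos hv]

theorem mem_of_mem_closedSimplex_of_pos {x : ι → ℝ} (hx : x ∈ closedSimplex s) (hv : 0 < x v) :
    v ∈ s := by
  by_contra h
  exact hv.ne' (hx.2.1 v h)

theorem exists_pos_of_mem_closedSimplex {x : ι → ℝ} (hx : x ∈ closedSimplex s) :
    ∃ v, 0 < x v := by
  by_contra! h
  have hsum := hx.2.2
  rw [Finset.sum_eq_zero fun i _ => le_antisymm (h i) (hx.1 i)] at hsum
  exact zero_ne_one hsum

variable {K : PreAbstractSimplicialComplex ι}

theorem mem_faces_of_subset (hs : s ∈ K.faces) (hts : t ⊆ s) (ht : t.Nonempty) : t ∈ K.faces :=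
  (K.isRelLowerSet_faces hs).2 hts ht

theorem singleton_mem_faces (hs : s ∈ K.faces) (hv : v ∈ s) : {v} ∈ K.faces :=
  mem_faces_of_subset hs (Finset.singleton_subset_iff.2 hv) (Finset.singleton_nonempty v)

theorem pair_mem_faces [DecidableEq ι] {w : ι} (hs : s ∈ K.faces) (hv : v ∈ s) (hw : w ∈ s) :
    {v, w} ∈ K.faces :=
  mem_faces_of_subset hs (Finset.insert_subset hv (Finset.singleton_subset_iff.2 hw))
    (Finset.insert_nonempty v {w})

theorem continuous_faceInclusion (s : K.faces) : Continuous (K.faceInclusion s) :=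
  continuous_iSup_rng (i := s) continuous_coinduced_rng

theorem isClosed_iff {C : Set K.Realization} :
    IsClosed C ↔ ∀ s : K.faces, IsClosed (K.faceInclusion s ⁻¹' C) := by
  simp only [← isOpen_compl_iff, isOpen_iSup_iff, isOpen_coinduced, Set.preimage_compl]

theorem continuous_coords : Continuous fun x : K.Realization => x.1 :=
  continuous_iSup_dom.2 fun _ => continuous_coinduced_dom.2 continuous_subtype_val

theorem continuous_of_finite_faces {X : Type*} [TopologicalSpace X] {f : X → K.Realization}
    {F : Set (Finset ι)} (hF : F.Finite) (hFK : F ⊆ K.faces) (hc : Continuous fun x => (f x).1)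
    (hf : ∀ x, ∃ s ∈ F, (f x).1 ∈ closedSimplex s) : Continuous f := by
  have : Finite F := hF
  refine (locallyFinite_of_finite fun s : F => {x | (f x).1 ∈ closedSimplex s.1}).continuous
    ?_ ?_ ?_
  · refine Set.eq_univ_of_forall fun x => ?_
    obtain ⟨s, hs, hx⟩ := hf x
    exact Set.mem_iUnion.2 ⟨⟨s, hs⟩, hx⟩
  · exact fun s => (isClosed_closedSimplex s.1).preimage hc
  · intro s
    rw [continuousOn_iff_continuous_domRestrict]
    exact (continuous_faceInclusion ⟨s.1, hFK s.2⟩).comp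
      (Continuous.subtype_mk (hc.comp continuous_subtype_val) fun x => x.2)

theorem finite_support (x : K.Realization) : {i | 0 < x.1 i}.Finite := by
  obtain ⟨s, _, hx⟩ := x.2
  exact s.finite_toSet.subset fun i hi => mem_of_mem_closedSimplex_of_pos hx hi

/-- The carrier of a point: the vertices of the open simplex that contains it. -/
noncomputable def carrier (x : K.Realization) : Finset ι := (finite_support x).toFinset

theorem mem_carrier {x : K.Realization} : v ∈ carrier x ↔ 0 < x.1 v := by
  simp [carrier]

theorem carrier_subset {x : K.Realization} (hx : x.1 ∈ closedSimplex s) : carrier x ⊆ s :=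
  fun _ hi => mem_of_mem_closedSimplex_of_pos hx (mem_carrier.1 hi)

theorem mem_closedSimplex_carrier (x : K.Realization) : x.1 ∈ closedSimplex (carrier x) := by
  obtain ⟨s, _, hx⟩ := x.2
  have hzero (i : ι) (hi : i ∉ carrier x) : x.1 i = 0 :=
    le_antisymm (not_lt.1 (mt mem_carrier.2 hi)) (hx.1 i)
  exact ⟨hx.1, hzero, by rw [Finset.sum_subset (carrier_subset hx) fun i _ => hzero i, hx.2.2]⟩

theorem carrier_mem_faces (x : K.Realization) : carrier x ∈ K.faces := by
  obtain ⟨s, hs, hx⟩ := x.2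
  obtain ⟨v, hv⟩ := exists_pos_of_mem_closedSimplex hx
  exact mem_faces_of_subset hs (carrier_subset hx) ⟨v, mem_carrier.2 hv⟩

theorem isClosed_of_injOn_carrier {A : Set K.Realization} (hA : Set.InjOn carrier A) :
    IsClosed A := by
  refine isClosed_iff.2 fun s => Set.Finite.isClosed ?_
  refine Set.Finite.of_finite_image (f := fun x => carrier (K.faceInclusion s x)) ?_ ?_
  · refine s.1.powerset.finite_toSet.subset ?_
    rintro _ ⟨x, _, rfl⟩
    exact Finset.mem_coe.2 (Finset.mem_powerset.2 (carrier_subset x.2))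
  · intro x hx y hy hxy
    exact Subtype.ext (congrArg (fun z : K.Realization => z.1) (hA hx hy hxy))

theorem finite_carrier_image {C : Set K.Realization} (hC : IsCompact C) :
    (carrier '' C).Finite := by
  by_contra hinf
  obtain ⟨A, hAC, hA⟩ := Set.exists_subset_bijOn C (carrier (K := K))
  have hAinf : A.Infinite := fun h => hinf (hA.image_eq ▸ h.image _)
  obtain ⟨x, _, hx⟩ := hAinf.exists_accPt_of_subset_isCompact hC hAC
  have hclosed : IsClosed (A \ {x}) :=
    isClosed_of_injOn_carrier (hA.injOn.mono Set.sdiff_subset)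
  rw [accPt_principal_iff_clusterPt, ← mem_closure_iff_clusterPt, hclosed.closure_eq] at hx
  exact hx.2 rfl

theorem homotopic_of_starConvex {X : Set (ι → ℝ)} {x₀ : ι → ℝ} (hx₀ : x₀ ∈ X)
    (hX : StarConvex ℝ x₀ X) {F : Set (Finset ι)} (hF : F.Finite) (hFK : F ⊆ K.faces)
    (hXF : ∀ x ∈ X, ∃ s ∈ F, x ∈ closedSimplex s) {a b : K.Realization} (γ γ' : Path a b)
    (hγ : ∀ t, (γ t).1 ∈ X) (hγ' : ∀ t, (γ' t).1 ∈ X) : γ.Homotopic γ' := by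
  have := hX.contractibleSpace ⟨x₀, hx₀⟩
  let φ : C(X, K.Realization) :=
    ⟨fun x => ⟨x.1, (hXF x.1 x.2).imp fun s hs => ⟨hFK hs.1, hs.2⟩⟩,
      continuous_of_finite_faces hF hFK continuous_subtype_val fun x => hXF x.1 x.2⟩
  have ha : a.1 ∈ X := by simpa only [Path.source] using hγ 0
  have hb : b.1 ∈ X := by simpa only [Path.target] using hγ 1
  let lift (δ : Path a b) (hδ : ∀ t, (δ t).1 ∈ X) : Path (⟨a.1, ha⟩ : X) ⟨b.1, hb⟩ :=
    { toFun := fun t => ⟨(δ t).1, hδ t⟩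
      continuous_toFun := (continuous_coords.comp δ.continuous).subtype_mk _
      source' := by simp
      target' := by simp }
  exact (SimplyConnectedSpace.paths_homotopic (lift γ hγ) (lift γ' hγ')).map φ

/-- The points of the realization that lie in the closed simplex on `s`. -/
def face (K : PreAbstractSimplicialComplex ι) (s : Finset ι) : Set K.Realization :=
  {x | x.1 ∈ closedSimplex s}

/-- The open star of `v`: the points of the realization with a nonzero `v`-coordinate. -/
def openStar (K : PreAbstractSimplicialComplex ι) (v : ι) : Set K.Realization :=
  {x | 0 < x.1 v}

theorem face_mono (h : s ⊆ t) : face K s ⊆ face K t :=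
  fun _ hx => closedSimplex_mono h hx

theorem isOpen_openStar (v : ι) : IsOpen (openStar K v) :=
  isOpen_lt continuous_const ((continuous_apply v).comp continuous_coords)

theorem homotopic_of_range_subset_face (hs : s ∈ K.faces) {a b : K.Realization}
    {γ γ' : Path a b} (hγ : Set.range γ ⊆ face K s) (hγ' : Set.range γ' ⊆ face K s) :
    γ.Homotopic γ' := by
  rw [Set.range_subset_iff] at hγ hγ'
  exact homotopic_of_starConvex (hγ 0) ((convex_closedSimplex s).starConvex (hγ 0))
    (Set.finite_singleton s) (Set.singleton_subset_iff.2 hs) (fun _ hx => ⟨s, rfl, hx⟩) γ γ' hγ hγ'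

theorem starConvex_iUnion_closedSimplex_inter_pos [DecidableEq ι] (F : Set (Finset ι)) (v : ι) :
    StarConvex ℝ (Pi.single v 1) {x : ι → ℝ | 0 < x v ∧ ∃ s ∈ F, x ∈ closedSimplex s} := by
  rintro x ⟨hxv, s, hs, hx⟩ p q hp hq hpq
  have hv := single_mem_closedSimplex (mem_of_mem_closedSimplex_of_pos hx hxv)
  refine ⟨?_, s, hs, convex_closedSimplex s hv hx hp hq hpq⟩
  exact convex_Ioi (0 : ℝ) (by simp : 0 < (Pi.single v 1 : ι → ℝ) v) hxv hp hq hpq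

theorem homotopic_of_range_subset_openStar {a b : K.Realization} {γ γ' : Path a b}
    (hγ : Set.range γ ⊆ openStar K v) (hγ' : Set.range γ' ⊆ openStar K v) : γ.Homotopic γ' := by
  classical
  let F := carrier '' (Set.range γ ∪ Set.range γ')
  have hF : F.Finite :=
    finite_carrier_image ((isCompact_range γ.continuous).union (isCompact_range γ'.continuous))
  have hFK : F ⊆ K.faces := by
    rintro _ ⟨x, _, rfl⟩
    exact carrier_mem_faces x
  let X : Set (ι → ℝ) := {x | 0 < x v ∧ ∃ s ∈ F, x ∈ closedSimplex s}
  have hmem (x : K.Realization) (hx : x ∈ Set.range γ ∪ Set.range γ') : x.1 ∈ X :=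
    ⟨Set.union_subset hγ hγ' hx, _, ⟨x, hx, rfl⟩, mem_closedSimplex_carrier x⟩
  have hsingle : Pi.single v 1 ∈ X := by
    obtain ⟨ha, s, hs, has⟩ := hmem a (.inl γ.source_mem_range)
    exact ⟨by simp, s, hs, single_mem_closedSimplex (mem_of_mem_closedSimplex_of_pos has ha)⟩
  exact homotopic_of_starConvex hsingle (starConvex_iUnion_closedSimplex_inter_pos F v) hF hFK
    (fun x hx => hx.2) γ γ' (fun t => hmem _ (.inl ⟨t, rfl⟩)) (fun t => hmem _ (.inr ⟨t, rfl⟩))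

theorem lineMap_mem_closedSimplex {x y : ι → ℝ} (hx : x ∈ closedSimplex s)
    (hy : y ∈ closedSimplex s) (r : I) : AffineMap.lineMap x y (r : ℝ) ∈ closedSimplex s :=
  (convex_closedSimplex s).lineMap_mem hx hy r.2

/-- The straight path between two points of a common face. -/
noncomputable def segmentPath (hs : s ∈ K.faces) {a b : K.Realization} (ha : a ∈ face K s)
    (hb : b ∈ face K s) : Path a b where
  toFun r := ⟨AffineMap.lineMap a.1 b.1 (r : ℝ), s, hs, lineMap_mem_closedSimplex ha hb r⟩
  continuous_toFun := continuous_of_finite_faces (Set.finite_singleton s)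
    (Set.singleton_subset_iff.2 hs) (by fun_prop)
    fun r => ⟨s, rfl, lineMap_mem_closedSimplex ha hb r⟩
  source' := Subtype.ext (by simp)
  target' := Subtype.ext (by simp)

theorem range_segmentPath_subset_face (hs : s ∈ K.faces) {a b : K.Realization}
    (ha : a ∈ face K s) (hb : b ∈ face K s) : Set.range (segmentPath hs ha hb) ⊆ face K s :=
  Set.range_subset_iff.2 fun r => lineMap_mem_closedSimplex ha hb r

theorem range_segmentPath_subset_openStar (hs : s ∈ K.faces) {a b : K.Realization}
    (ha : a ∈ face K s) (hb : b ∈ face K s) (hav : a ∈ openStar K v) (hbv : b ∈ openStar K v) :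
    Set.range (segmentPath hs ha hb) ⊆ openStar K v := by
  refine Set.range_subset_iff.2 fun r => ?_
  change 0 < AffineMap.lineMap a.1 b.1 (r : ℝ) v
  rw [AffineMap.pi_lineMap_apply]
  exact (convex_Ioi (0 : ℝ)).lineMap_mem hav hbv r.2

theorem exists_mem_openStar (a : K.Realization) : ∃ x : K.vertexSet, a ∈ openStar K x.1 := by
  obtain ⟨v, hv⟩ := exists_pos_of_mem_closedSimplex (mem_closedSimplex_carrier a)
  exact ⟨⟨v, singleton_mem_faces (carrier_mem_faces a) (mem_carrier.2 hv)⟩, hv⟩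

open Path.Homotopic.Quotient

variable [DecidableEq ι]

/-- The vertices of `K` as points of its realization. -/
noncomputable def vertexPoint (v : K.vertexSet) : K.Realization :=
  ⟨Pi.single v.1 1, {v.1}, v.2, single_mem_closedSimplex (Finset.mem_singleton_self v.1)⟩

theorem vertexPoint_mem_face {v : K.vertexSet} (hv : v.1 ∈ s) : vertexPoint v ∈ face K s :=
  single_mem_closedSimplex hv

theorem vertexPoint_mem_openStar (v : K.vertexSet) : vertexPoint v ∈ openStar K v.1 := by
  change 0 < (Pi.single v.1 1 : ι → ℝ) v.1
  simp

variable {x y z : K.vertexSet} {a b : K.Realization}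

/-- The homotopy class of the straight path along an edge, which may be degenerate. -/
noncomputable def edgeClass (h : {x.1, y.1} ∈ K.faces) :
    Path.Homotopic.Quotient (vertexPoint x) (vertexPoint y) :=
  mk (segmentPath h (vertexPoint_mem_face (by simp)) (vertexPoint_mem_face (by simp)))

theorem mk_eq_edgeClass {γ : Path (vertexPoint x) (vertexPoint y)} (hs : s ∈ K.faces)
    (hγ : Set.range γ ⊆ face K s) (h : {x.1, y.1} ∈ K.faces) (hxy : {x.1, y.1} ⊆ s) :
    mk γ = edgeClass h :=
  eq.2 (homotopic_of_range_subset_face hs hγ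
    ((range_segmentPath_subset_face h _ _).trans (face_mono hxy)))

theorem edgeClass_self (h : {x.1, x.1} ∈ K.faces) : edgeClass h = .refl (vertexPoint x) := by
  rw [← mk_refl, mk_eq_edgeClass h _ h subset_rfl]
  rw [Path.refl_range, Set.singleton_subset_iff]
  exact vertexPoint_mem_face (by simp)

theorem edgeClass_symm (h : {x.1, y.1} ∈ K.faces) (h' : {y.1, x.1} ∈ K.faces) :
    (edgeClass h).symm = edgeClass h' := by
  rw [edgeClass, ← mk_symm, mk_eq_edgeClass h _ h' (Finset.pair_comm _ _).subset]
  rw [Path.symm_range]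
  exact range_segmentPath_subset_face h _ _

theorem edgeClass_trans (h : {x.1, y.1, z.1} ∈ K.faces) (hxy : {x.1, y.1} ∈ K.faces)
    (hyz : {y.1, z.1} ∈ K.faces) (hxz : {x.1, z.1} ∈ K.faces) :
    (edgeClass hxy).trans (edgeClass hyz) = edgeClass hxz := by
  rw [edgeClass, edgeClass, ← mk_trans, mk_eq_edgeClass h _ hxz (by grind)]
  rw [Path.trans_range]
  exact Set.union_subset
    ((range_segmentPath_subset_face hxy _ _).trans (face_mono (by grind)))
    ((range_segmentPath_subset_face hyz _ _).trans (face_mono (by grind)))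

/-- The straight path from a vertex to a point of its open star. -/
noncomputable def starPath (h : a ∈ openStar K x.1) : Path (vertexPoint x) a :=
  segmentPath (carrier_mem_faces a) (vertexPoint_mem_face (mem_carrier.2 h))
    (mem_closedSimplex_carrier a)

theorem edgeClass_trans_starPath (hx : a ∈ openStar K x.1) (hy : a ∈ openStar K y.1)
    (h : {x.1, y.1} ∈ K.faces) :
    (edgeClass h).trans (mk (starPath hy)) = mk (starPath hx) := by
  rw [edgeClass, ← mk_trans, eq]
  refine homotopic_of_range_subset_face (carrier_mem_faces a) ?_
    (range_segmentPath_subset_face _ _ _)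
  rw [Path.trans_range]
  refine Set.union_subset ((range_segmentPath_subset_face h _ _).trans (face_mono ?_))
    (range_segmentPath_subset_face _ _ _)
  exact Finset.insert_subset (mem_carrier.2 hx) (Finset.singleton_subset_iff.2 (mem_carrier.2 hy))

theorem starPath_trans (ha : a ∈ openStar K x.1) (hb : b ∈ openStar K x.1) {γ : Path a b}
    (hγ : Set.range γ ⊆ openStar K x.1) :
    (mk (starPath ha)).trans (mk γ) = mk (starPath hb) := by
  have hstar {c : K.Realization} (hc : c ∈ openStar K x.1) :
      Set.range (starPath hc) ⊆ openStar K x.1 :=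
    range_segmentPath_subset_openStar _ _ _ (vertexPoint_mem_openStar x) hc
  rw [← mk_trans, eq]
  refine homotopic_of_range_subset_openStar ?_ (hstar hb)
  rw [Path.trans_range]
  exact Set.union_subset (hstar ha) hγ

theorem simplyConnectedSpace_of_section {x₀ : K.vertexSet}
    (P : ∀ x : K.vertexSet, Path.Homotopic.Quotient (vertexPoint x₀) (vertexPoint x))
    (hP : ∀ (x y : K.vertexSet) (h : {x.1, y.1} ∈ K.faces), (P x).trans (edgeClass h) = P y) :
    SimplyConnectedSpace K.Realization := by
  choose c hc using exists_mem_openStar (K := K)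
  have change_star {x : K.vertexSet} {a : K.Realization} (hx : a ∈ openStar K x.1) :
      (P (c a)).trans (mk (starPath (hc a))) = (P x).trans (mk (starPath hx)) := by
    have hedge : {(c a).1, x.1} ∈ K.faces :=
      pair_mem_faces (carrier_mem_faces a) (mem_carrier.2 (hc a)) (mem_carrier.2 hx)
    rw [← edgeClass_trans_starPath (hc a) hx hedge, ← trans_assoc, hP]
  refine simplyConnectedSpace_of_openCover (U := fun x : K.vertexSet => openStar K x.1)
    (fun x => isOpen_openStar x.1)
    (Set.eq_univ_of_forall fun a => Set.mem_iUnion.2 (exists_mem_openStar a))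
    (fun a => (P (c a)).trans (mk (starPath (hc a)))) fun x a b γ hγ => ?_
  have ha : a ∈ openStar K x.1 := hγ γ.source_mem_range
  have hb : b ∈ openStar K x.1 := hγ γ.target_mem_range
  rw [change_star ha, change_star hb, trans_assoc, starPath_trans ha hb hγ]

/-- The graph of the edges of the link of `v` that descend with respect to the height `f`: its
vertices are the neighbours of `v` of smaller height, and two of them are adjacent if they span a
`2`-simplex with `v`. -/
def descendingLink (K : PreAbstractSimplicialComplex ι) (f : ι → ℕ) (v : ι) :
    SimpleGraph {u : ι // f u < f v ∧ {u, v} ∈ K.faces} where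
  Adj x y := x ≠ y ∧ {x.1, y.1, v} ∈ K.faces
  symm.symm x y h := ⟨h.1.symm, Finset.insert_comm x.1 y.1 {v} ▸ h.2⟩
  loopless.irrefl _ h := h.1 rfl

variable {f : ι → ℕ} {x₀ : K.vertexSet}
  {P : ∀ v : K.vertexSet, Path.Homotopic.Quotient (vertexPoint x₀) (vertexPoint v)}

theorem exists_descending_section
    (hcone : ∀ v, {v} ∈ K.faces → f v = 0 → {x₀.1, v} ∈ K.faces)
    (hlink : ∀ v, {v} ∈ K.faces → 0 < f v → (descendingLink K f v).Connected) :
    ∃ P : ∀ v : K.vertexSet, Path.Homotopic.Quotient (vertexPoint x₀) (vertexPoint v),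
      (∀ (v : K.vertexSet) (h : {x₀.1, v.1} ∈ K.faces), f v = 0 → P v = edgeClass h) ∧
      ∀ v : K.vertexSet, 0 < f v → ∃ (u : K.vertexSet) (h : {u.1, v.1} ∈ K.faces),
        f u < f v ∧ P v = (P u).trans (edgeClass h) := by
  have parent (v : K.vertexSet) (hv : f v ≠ 0) :
      ∃ (u : K.vertexSet) (_ : {u.1, v.1} ∈ K.faces), f u < f v := by
    obtain ⟨⟨u, hlt, huv⟩⟩ := (hlink v v.2 (Nat.pos_of_ne_zero hv)).nonempty
    exact ⟨⟨u, singleton_mem_faces huv (by simp)⟩, huv, hlt⟩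
  choose p hp hlt using parent
  let P : ∀ v : K.vertexSet, Path.Homotopic.Quotient (vertexPoint x₀) (vertexPoint v) :=
    (measure fun v : K.vertexSet => f v).wf.fix fun v ih =>
      if hv : f v = 0 then edgeClass (hcone v v.2 hv)
      else (ih (p v hv) (hlt v hv)).trans (edgeClass (hp v hv))
  refine ⟨P, fun v h hv => ?_, fun v hv => ⟨p v hv.ne', hp v hv.ne', hlt v hv.ne', ?_⟩⟩
  · rw [show P v = _ from WellFounded.fix_eq _ _ _, dif_pos hv]
  · rw [show P v = _ from WellFounded.fix_eq _ _ _, dif_neg hv.ne']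

theorem trans_edgeClass_eq_of_reachable {v : K.vertexSet}
    (hP : ∀ (x y : K.vertexSet) (h : {x.1, y.1} ∈ K.faces), f x < f v → f y < f v →
      (P x).trans (edgeClass h) = P y)
    {u u' : {u : ι // f u < f v ∧ {u, v.1} ∈ K.faces}}
    (huu' : (descendingLink K f v).Reachable u u')
    (hu : {u.1} ∈ K.faces) (hu' : {u'.1} ∈ K.faces) :
    (P ⟨u, hu⟩).trans (edgeClass (y := v) u.2.2) =
      (P ⟨u', hu'⟩).trans (edgeClass (y := v) u'.2.2) := by
  obtain ⟨walk⟩ := huu'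
  induction walk with
  | nil => rfl
  | @cons u w u' huw _ ih =>
    have hw : {w.1} ∈ K.faces := singleton_mem_faces w.2.2 (by simp)
    have hedge : {u.1, w.1} ∈ K.faces := pair_mem_faces huw.2 (by simp) (by simp)
    rw [← ih hw hu', ← hP ⟨u, hu⟩ ⟨w, hw⟩ hedge u.2.1 w.2.1, trans_assoc,
      edgeClass_trans huw.2 hedge w.2.2 u.2.2]

theorem trans_edgeClass_eq_of_connected {v : K.vertexSet}
    (hP : ∀ (x y : K.vertexSet) (h : {x.1, y.1} ∈ K.faces), f x < f v → f y < f v →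
      (P x).trans (edgeClass h) = P y)
    (hlink : (descendingLink K f v).Connected)
    (hparent : ∃ (u : K.vertexSet) (h : {u.1, v.1} ∈ K.faces),
      f u < f v ∧ P v = (P u).trans (edgeClass h))
    {u : K.vertexSet} (h : {u.1, v.1} ∈ K.faces) (huv : f u < f v) :
    (P u).trans (edgeClass h) = P v := by
  obtain ⟨u', h', hu'v, hPv⟩ := hparent
  rw [hPv]
  exact trans_edgeClass_eq_of_reachable hP
    (hlink.preconnected ⟨u, huv, h⟩ ⟨u', hu'v, h'⟩) u.2 u'.2

theorem trans_edgeClass_eq_of_reverse {x y : K.vertexSet} (h : {x.1, y.1} ∈ K.faces)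
    (h' : {y.1, x.1} ∈ K.faces) (hyx : (P y).trans (edgeClass h') = P x) :
    (P x).trans (edgeClass h) = P y := by
  rw [← hyx, ← edgeClass_symm h' h, trans_assoc, trans_symm, trans_refl]

theorem trans_edgeClass_eq_of_triangle {w x y : K.vertexSet}
    (htri : {w.1, x.1, y.1} ∈ K.faces) (hwx : {w.1, x.1} ∈ K.faces)
    (hwy : {w.1, y.1} ∈ K.faces) (hxy : {x.1, y.1} ∈ K.faces)
    (hx : (P w).trans (edgeClass hwx) = P x) (hy : (P w).trans (edgeClass hwy) = P y) :
    (P x).trans (edgeClass hxy) = P y := by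
  rw [← hx, ← hy, trans_assoc, edgeClass_trans htri]

theorem simplyConnectedSpace_of_height
    (hcone : ∀ x y, {x, y} ∈ K.faces → f x = 0 → f y = 0 → {x₀.1, x, y} ∈ K.faces)
    (hlink : ∀ v, {v} ∈ K.faces → 0 < f v → (descendingLink K f v).Connected)
    (hhorizontal : ∀ x y, {x, y} ∈ K.faces → x ≠ y → f x = f y → 0 < f x →
      ∃ w, f w < f x ∧ {w, x, y} ∈ K.faces) :
    SimplyConnectedSpace K.Realization := by
  have hcone₁ (v : ι) (hv : {v} ∈ K.faces) (hfv : f v = 0) : {x₀.1, v} ∈ K.faces := by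
    simpa using hcone v v (by simpa using hv) hfv hfv
  obtain ⟨P, hbase, hparent⟩ := exists_descending_section hcone₁ hlink
  suffices hlevel : ∀ n, ∀ (x y : K.vertexSet) (h : {x.1, y.1} ∈ K.faces), f x < n → f y < n →
      (P x).trans (edgeClass h) = P y from
    simplyConnectedSpace_of_section P fun x y h => hlevel _ x y h
      (Nat.lt_succ_of_le (le_max_left (f x) (f y))) (Nat.lt_succ_of_le (le_max_right _ _))
  intro n
  induction n with
  | zero => exact fun x y h hx => absurd hx (Nat.not_lt_zero _)
  | succ n ih =>
    have descend (u v : K.vertexSet) (h : {u.1, v.1} ∈ K.faces) (huv : f u < f v)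
        (hv : f v ≤ n) : (P u).trans (edgeClass h) = P v :=
      trans_edgeClass_eq_of_connected
        (fun x y h hx hy => ih x y h (hx.trans_le hv) (hy.trans_le hv))
        (hlink v v.2 (Nat.zero_lt_of_lt huv)) (hparent v (Nat.zero_lt_of_lt huv)) h huv
    intro x y h hx hy
    rw [Nat.lt_succ_iff] at hx hy
    rcases lt_trichotomy (f x) (f y) with hxy | hxy | hxy
    · exact descend x y h hxy hy
    · rcases eq_or_ne x y with rfl | hne
      · rw [edgeClass_self, trans_refl]
      rcases (f x).eq_zero_or_pos with hzero | hpos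
      · have htri := hcone x y h hzero (hxy ▸ hzero)
        rw [hbase x (pair_mem_faces htri (by simp) (by simp)) hzero, hbase y
          (pair_mem_faces htri (by simp) (by simp)) (hxy ▸ hzero), edgeClass_trans htri]
      · obtain ⟨w, hw, htri⟩ := hhorizontal x y h (Subtype.coe_ne_coe.2 hne) hxy hpos
        lift w to K.vertexSet using singleton_mem_faces htri (by simp)
        have hwx := pair_mem_faces htri (v := w.1) (w := x.1) (by simp) (by simp)
        have hwy := pair_mem_faces htri (v := w.1) (w := y.1) (by simp) (by simp)
        exact trans_edgeClass_eq_of_triangle htri hwx hwy h (descend w x hwx hw hx)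
          (descend w y hwy (hxy ▸ hw) hy)
    · have h' : {y.1, x.1} ∈ K.faces := Finset.pair_comm x.1 y.1 ▸ h
      exact trans_edgeClass_eq_of_reverse h h' (descend y x h' hxy hx)

end SimplicialRealization

namespace PalindromicComplex

open SimplicialRealization

section TripleDet

variable {R : Type*} [CommRing R]

/-- The determinant of three vectors of `R³`, written as the rows of a matrix. -/
def tripleDet (x y z : Fin 3 → R) : R :=
  (Matrix.of ![x, y, z]).det

theorem tripleDet_eq (x y z : Fin 3 → R) :
    tripleDet x y z = x 0 * (y 1 * z 2 - y 2 * z 1) - x 1 * (y 0 * z 2 - y 2 * z 0) +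
      x 2 * (y 0 * z 1 - y 1 * z 0) := by
  rw [tripleDet, Matrix.det_fin_three]
  change x 0 * y 1 * z 2 - x 0 * y 2 * z 1 - x 1 * y 0 * z 2 + x 1 * y 2 * z 0 +
    x 2 * y 0 * z 1 - x 2 * y 1 * z 0 = _
  ring

theorem tripleDet_swap (x y z : Fin 3 → R) : tripleDet y x z = -tripleDet x y z := by
  simp only [tripleDet_eq]
  ring

theorem tripleDet_rotate (x y z : Fin 3 → R) : tripleDet y z x = tripleDet x y z := by
  simp only [tripleDet_eq]
  ring

theorem isUnit_tripleDet_swap {x y z : Fin 3 → R} :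
    IsUnit (tripleDet y x z) ↔ IsUnit (tripleDet x y z) := by
  rw [tripleDet_swap, IsUnit.neg_iff]

theorem tripleDet_comb (v y z : Fin 3 → R) (α a b β c d : R) :
    tripleDet v (α • v + a • y + b • z) (β • v + c • y + d • z) =
      (a * d - b * c) * tripleDet v y z := by
  simp only [tripleDet_eq, Pi.add_apply, Pi.smul_apply, smul_eq_mul]
  ring

theorem tripleDet_add_smul (x y z w : Fin 3 → R) (c : R) :
    tripleDet x y (z + c • w) = tripleDet x y z + c * tripleDet x y w := by
  simp only [tripleDet_eq, Pi.add_apply, Pi.smul_apply, smul_eq_mul]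
  ring

theorem tripleDet_add_smul_first (x y z : Fin 3 → R) (c : R) :
    tripleDet x y (z + c • x) = tripleDet x y z := by
  simp only [tripleDet_eq, Pi.add_apply, Pi.smul_apply, smul_eq_mul]
  ring

theorem tripleDet_smul_eq_cramer (x y z u : Fin 3 → R) :
    tripleDet x y z • u =
      tripleDet u y z • x + tripleDet x u z • y + tripleDet x y u • z := by
  ext i
  simp only [tripleDet_eq, Pi.add_apply, Pi.smul_apply, smul_eq_mul]
  match i with
  | 0 | 1 | 2 => ring

theorem tripleDet_mul_tripleDet_plucker (v y z p q : Fin 3 → R) :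
    tripleDet v y z * tripleDet v p q =
      tripleDet v y p * tripleDet v z q - tripleDet v y q * tripleDet v z p := by
  simp only [tripleDet_eq]
  ring

theorem exists_eq_smul_add_smul_add_smul {v y z : Fin 3 → R}
    (h : IsUnit (tripleDet v y z)) (u : Fin 3 → R) :
    ∃ α a b : R, u = α • v + a • y + b • z := by
  obtain ⟨δ, hδ⟩ := h.exists_left_inv
  refine ⟨δ * tripleDet u y z, δ * tripleDet v u z, δ * tripleDet v y u, ?_⟩
  calc u = δ • tripleDet v y z • u := by rw [smul_smul, hδ, one_smul]
    _ = _ := by rw [tripleDet_smul_eq_cramer v y z u]; simp only [smul_add, smul_smul]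

theorem tripleDet_single_two (x y : Fin 3 → R) :
    tripleDet x y (Pi.single 2 1) = x 0 * y 1 - x 1 * y 0 := by
  simp [tripleDet_eq]

theorem tripleDet_single (v : Fin 3 → R) (j : Fin 3) :
    tripleDet v (Pi.single (j + 1) 1) (Pi.single (j + 2) 1) = v j := by
  fin_cases j <;> simp [tripleDet_eq]

end TripleDet

section Bases

variable {x y z : Fin 3 → ℤ}

theorem exists_basis_of_isUnit_tripleDet (h : IsUnit (tripleDet x y z)) :
    ∃ b : Module.Basis (Fin 3) ℤ (Fin 3 → ℤ), ⇑b = ![x, y, z] := by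
  rw [tripleDet, ← Pi.basisFun_det_apply] at h
  obtain ⟨hli, hsp⟩ := (Module.Basis.is_basis_iff_det _).2 h
  exact ⟨.mk hli hsp.ge, Module.Basis.coe_mk hli hsp.ge⟩

theorem isUnit_tripleDet_basis (b : Module.Basis (Fin 3) ℤ (Fin 3 → ℤ)) :
    IsUnit (tripleDet (b 0) (b 1) (b 2)) := by
  have hb : ![b 0, b 1, b 2] = b := by
    funext i
    fin_cases i <;> rfl
  rw [tripleDet, ← Pi.basisFun_det_apply, hb]
  exact (Pi.basisFun ℤ (Fin 3)).isUnit_det b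

theorem exists_isUnit_tripleDet_of_pair_mem
    (h : {x, y} ∈ (partialBasisComplex 3).faces) (hxy : x ≠ y) :
    ∃ z, IsUnit (tripleDet x y z) := by
  obtain ⟨_, b, hb⟩ := h
  obtain ⟨i, rfl⟩ := hb (Finset.mem_coe.2 (Finset.mem_insert_self x {y}))
  obtain ⟨j, rfl⟩ := hb (Finset.mem_coe.2 (Finset.mem_insert_of_mem (Finset.mem_singleton_self y)))
  have hperm : ∀ i j : Fin 3, i ≠ j → ∃ e : Equiv.Perm (Fin 3), e 0 = i ∧ e 1 = j := by decide
  obtain ⟨e, rfl, rfl⟩ := hperm i j (ne_of_apply_ne b hxy)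
  exact ⟨b (e 2), by simpa using isUnit_tripleDet_basis (b.reindex e.symm)⟩

theorem exists_isUnit_tripleDet_of_mem_vertexSet
    (h : x ∈ (partialBasisComplex 3).vertexSet) : ∃ y z, IsUnit (tripleDet x y z) := by
  obtain ⟨_, b, hb⟩ := h
  obtain ⟨i, rfl⟩ := hb (Finset.mem_coe.2 (Finset.mem_singleton_self x))
  obtain ⟨j, hij⟩ := exists_ne i
  refine ⟨b j, exists_isUnit_tripleDet_of_pair_mem ⟨Finset.insert_nonempty _ _, b, ?_⟩
    (b.injective.ne hij.symm)⟩
  simp [Set.insert_subset_iff]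

theorem triple_mem_partialBasisComplex (h : IsUnit (tripleDet x y z)) :
    {x, y, z} ∈ (partialBasisComplex 3).faces := by
  obtain ⟨b, hb⟩ := exists_basis_of_isUnit_tripleDet h
  refine ⟨Finset.insert_nonempty _ _, b, ?_⟩
  simp [hb, Set.insert_subset_iff]

theorem odd_of_isUnit {n : ℤ} (h : IsUnit n) : Odd n := by
  rcases Int.isUnit_iff.1 h with rfl | rfl <;> decide

theorem exists_odd_sub_of_isUnit_tripleDet (h : IsUnit (tripleDet x y z)) :
    ∃ i, Odd (x i - y i) := by
  by_contra! hcon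
  simp only [Int.not_odd_iff_even, even_iff_exists_two_mul] at hcon
  choose s hs using hcon
  have hx : x = (2 : ℤ) • s + y := by
    ext i
    simp [← hs]
  have heven : tripleDet x y z = 2 * tripleDet s y z := by
    rw [hx]
    simp only [tripleDet_eq, Pi.add_apply, Pi.smul_apply, smul_eq_mul]
    ring
  rw [heven, IsUnit.mul_iff] at h
  exact absurd h.1 (by decide)

theorem exists_isUnit_tripleDet_add_two_smul (h : IsUnit (tripleDet x y z)) {w : Fin 3 → ℤ}
    (hw : Odd (tripleDet x y w)) : ∃ s, IsUnit (tripleDet x y (w + (2 : ℤ) • s)) := by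
  obtain ⟨k, hk⟩ := hw
  refine ⟨(-k * tripleDet x y z) • z, IsUnit.of_mul_eq_one 1 ?_⟩
  rw [smul_smul, tripleDet_add_smul, hk]
  linear_combination -2 * k * Int.isUnit_mul_self h

theorem exists_isUnit_tripleDet_add_two_smul_pair (h : IsUnit (tripleDet x y z)) {p q : Fin 3 → ℤ}
    (hpq : Odd (tripleDet x p q)) :
    ∃ s t, IsUnit (tripleDet x (p + (2 : ℤ) • s) (q + (2 : ℤ) • t)) := by
  wlog hp : Odd (tripleDet x y p) generalizing y z
  · have hunit : IsUnit (tripleDet x z y) := by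
      rwa [tripleDet_rotate y, isUnit_tripleDet_swap]
    have hodd : Odd (tripleDet x y z * tripleDet x p q) := (odd_of_isUnit h).mul hpq
    rw [tripleDet_mul_tripleDet_plucker, Int.odd_sub, ← Int.not_odd_iff_even] at hodd
    simp only [Int.odd_mul] at hodd
    exact this hunit (by tauto)
  obtain ⟨s, hs⟩ := exists_isUnit_tripleDet_add_two_smul h hp
  have hodd : Odd (tripleDet x (p + (2 : ℤ) • s) q) := by
    have hexpand : tripleDet x (p + (2 : ℤ) • s) q = tripleDet x p q + 2 * tripleDet x s q := by
      simp only [tripleDet_eq, Pi.add_apply, Pi.smul_apply, smul_eq_mul]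
      ring
    rw [hexpand]
    exact hpq.add_even (even_two_mul _)
  have hs' : IsUnit (tripleDet x (p + (2 : ℤ) • s) y) := by
    rwa [tripleDet_rotate y, isUnit_tripleDet_swap]
  exact ⟨s, exists_isUnit_tripleDet_add_two_smul hs' hodd⟩

end Bases

section Admissible

/-- The parity condition cutting the vertices of `𝒴` out of those of `ℬ₃(ℤ)`: the reduction of `v`
modulo `2` is one of `e₁`, `e₂`, `e₁ + e₂` and `e₃`. -/
def Admissible (v : Fin 3 → ℤ) : Prop :=
  Odd (v 2) ↔ Even (v 0) ∧ Even (v 1)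

variable {v y z : Fin 3 → ℤ}

theorem odd_add_two_smul_apply_iff {n : ℕ} (x s : Fin n → ℤ) (i : Fin n) :
    Odd ((x + (2 : ℤ) • s) i) ↔ Odd (x i) := by
  simp [parity_simps]

theorem odd_single_add_two_smul_apply_iff {n : ℕ} (k i : Fin n) (s : Fin n → ℤ) :
    Odd ((Pi.single k 1 + (2 : ℤ) • s : Fin n → ℤ) i) ↔ i = k := by
  rw [odd_add_two_smul_apply_iff, Pi.single_apply]
  split_ifs with h <;> simp [h]

theorem admissible_single (k : Fin 3) : Admissible (Pi.single k 1) := by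
  fin_cases k <;> simp [Admissible]

theorem admissible_iff : Admissible v ↔
    (∃ j, ∀ i, Odd (v i) ↔ i = j) ∨ Odd (v 0) ∧ Odd (v 1) ∧ Even (v 2) := by
  simp only [Admissible, ← Int.not_odd_iff_even, Fin.exists_fin_succ, Fin.forall_fin_succ]
  grind

theorem admissible_of_even (h : Even (v 2)) (hv : ∃ i, Odd (v i)) : Admissible v := by
  simp only [Admissible, ← Int.not_odd_iff_even, Fin.exists_fin_succ] at *
  grind

theorem admissible_add_two_smul_iff (v s : Fin 3 → ℤ) :
    Admissible (v + (2 : ℤ) • s) ↔ Admissible v := by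
  simp only [Admissible, ← Int.not_odd_iff_even, odd_add_two_smul_apply_iff]

theorem Admissible.exists_odd (hv : Admissible v) : ∃ j, Odd (v j) := by
  by_contra! hcon
  exact hcon 2 (hv.2 ⟨Int.not_odd_iff_even.1 (hcon 0), Int.not_odd_iff_even.1 (hcon 1)⟩)

theorem Admissible.comb (hy : Admissible y) (hz : Admissible z) {c d : ℤ} (hcd : Odd (c + d)) :
    Admissible (c • y + d • z) := by
  wlog hc : Even c generalizing c d y z
  · rw [add_comm] at hcd ⊢
    exact this hz hy hcd ((Int.odd_add'.1 hcd).1 (Int.not_even_iff_odd.1 hc))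
  obtain ⟨k, rfl⟩ := hc.exists_two_nsmul
  obtain ⟨m, rfl⟩ : Odd d := (Int.odd_add'.1 hcd).2 (by simp)
  convert (admissible_add_two_smul_iff z (k • y + m • z)).2 hz using 1
  module

theorem Admissible.exists_completion (hv : Admissible v)
    (hvert : v ∈ (partialBasisComplex 3).vertexSet) :
    ∃ y z, Admissible y ∧ Admissible z ∧ IsUnit (tripleDet v y z) := by
  obtain ⟨_, _, hdet⟩ := exists_isUnit_tripleDet_of_mem_vertexSet hvert
  obtain ⟨j, hj⟩ := hv.exists_odd
  obtain ⟨s, t, hst⟩ :=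
    exists_isUnit_tripleDet_add_two_smul_pair hdet (tripleDet_single v j ▸ hj)
  exact ⟨_, _, (admissible_add_two_smul_iff _ s).2 (admissible_single _),
    (admissible_add_two_smul_iff _ t).2 (admissible_single _), hst⟩

end Admissible

section AugmentedComplex

variable {v x y z : Fin 3 → ℤ}

theorem mem_levelTwo_iff {n : ℕ} {M : Matrix.GeneralLinearGroup (Fin n) ℤ} :
    M ∈ levelTwo n ↔ ∀ i j, Odd (M i j) ↔ i = j := by
  rw [levelTwo, MonoidHom.mem_ker, Matrix.GeneralLinearGroup.ext_iff]
  refine forall₂_congr fun i j => ?_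
  rcases eq_or_ne i j with rfl | hij
  · simp [ZMod.intCast_eq_one_iff_odd]
  · simp [hij, ZMod.intCast_zmod_eq_zero_iff_dvd, even_iff_two_dvd]

theorem mem_vertexSet_partialPiBasisComplex_iff {n : ℕ} {v : Fin n → ℤ} :
    v ∈ (partialPiBasisComplex n).vertexSet ↔
      ∃ M ∈ levelTwo n, ∃ j, (M : Matrix (Fin n) (Fin n) ℤ).col j = v := by
  simp [PreAbstractSimplicialComplex.vertexSet, partialPiBasisComplex, IsPiBasis]

theorem exists_odd_iff_of_mem_vertexSet {n : ℕ} {v : Fin n → ℤ}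
    (hv : v ∈ (partialPiBasisComplex n).vertexSet) : ∃ j, ∀ i, Odd (v i) ↔ i = j := by
  obtain ⟨M, hM, j, rfl⟩ := mem_vertexSet_partialPiBasisComplex_iff.1 hv
  exact ⟨j, fun i => mem_levelTwo_iff.1 hM i j⟩

theorem mem_vertexSet_partialPiBasisComplex {j : Fin 3}
    (hvert : v ∈ (partialBasisComplex 3).vertexSet) (hv : ∀ i, Odd (v i) ↔ i = j) :
    v ∈ (partialPiBasisComplex 3).vertexSet := by
  obtain ⟨_, _, hdet⟩ := exists_isUnit_tripleDet_of_mem_vertexSet hvert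
  obtain ⟨s, t, hst⟩ := exists_isUnit_tripleDet_add_two_smul_pair hdet
    (tripleDet_single v j ▸ (hv j).2 rfl)
  set c : Fin 3 → Fin 3 → ℤ :=
    ![v, Pi.single (j + 1) 1 + (2 : ℤ) • s, Pi.single (j + 2) 1 + (2 : ℤ) • t] with hc
  have hparity (l i : Fin 3) : Odd (c l i) ↔ i = j + l := by
    fin_cases l
    · simpa [hc] using hv i
    all_goals exact odd_single_add_two_smul_apply_iff _ i _
  have hunit : IsUnit ((Matrix.of c).submatrix (Equiv.subRight j) id).transpose := by
    rw [Matrix.isUnit_iff_isUnit_det, Matrix.det_transpose, Matrix.det_permute]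
    exact ((Equiv.Perm.sign (Equiv.subRight j)).isUnit.map (Int.castRingHom ℤ)).mul hst
  obtain ⟨M, hM⟩ := hunit
  refine mem_vertexSet_partialPiBasisComplex_iff.2
    ⟨M, mem_levelTwo_iff.2 fun i k => ?_, j, ?_⟩
  · simpa [hM] using hparity (k - j) i
  · ext i
    simp [hM, hc]

theorem mem_faces_augmentedComplex_iff {s : Finset (Fin 3 → ℤ)} :
    s ∈ augmentedComplex.faces ↔
      s ∈ (partialBasisComplex 3).faces ∧ ∀ v ∈ s, Admissible v := by
  refine and_congr_right fun hs => forall₂_congr fun v hv => ?_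
  have hvert : v ∈ (partialBasisComplex 3).vertexSet := singleton_mem_faces hs hv
  rw [admissible_iff]
  refine or_congr ⟨exists_odd_iff_of_mem_vertexSet, fun ⟨_, hj⟩ => ?_⟩ (and_iff_right hvert)
  exact mem_vertexSet_partialPiBasisComplex hvert hj

theorem Admissible.triple_mem (hx : Admissible x) (hy : Admissible y) (hz : Admissible z)
    (h : IsUnit (tripleDet x y z)) : {x, y, z} ∈ augmentedComplex.faces :=
  mem_faces_augmentedComplex_iff.2 ⟨triple_mem_partialBasisComplex h, by simp [hx, hy, hz]⟩

theorem Admissible.pair_mem (hx : Admissible x) (hy : Admissible y)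
    (h : IsUnit (tripleDet x y z)) : {x, y} ∈ augmentedComplex.faces :=
  mem_faces_augmentedComplex_iff.2
    ⟨pair_mem_faces (triple_mem_partialBasisComplex h) (by simp) (by simp), by simp [hx, hy]⟩

end AugmentedComplex

section Arithmetic

variable {m n a b : ℤ}

theorem exists_natAbs_add_mul_lt (m : ℤ) (hn : n ≠ 0) :
    ∃ q : ℤ, (m + q * n).natAbs < n.natAbs := by
  refine ⟨-(m / n), ?_⟩
  rw [show m + -(m / n) * n = m % n by rw [Int.emod_def]; ring]
  have hnonneg := Int.emod_nonneg m hn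
  have hlt := Int.emod_lt m hn
  omega

theorem exists_natAbs_add_two_mul_le (m : ℤ) (hn : n ≠ 0) :
    ∃ q : ℤ, (m + 2 * q * n).natAbs ≤ n.natAbs := by
  obtain ⟨q, hq⟩ := Int.dvd_bmod_sub_self (x := m) (m := 2 * n.natAbs)
  obtain ⟨r, hr⟩ := Int.natCast_natAbs n ▸ (dvd_abs n n).2 dvd_rfl
  have hlow := Int.le_bmod (x := m) (m := 2 * n.natAbs) (by omega)
  have hupp := Int.bmod_lt (x := m) (m := 2 * n.natAbs) (by omega)
  refine ⟨r * q, ?_⟩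
  rw [show m + 2 * (r * q) * n = m.bmod (2 * n.natAbs) by
    push_cast [hr] at hq
    linarith]
  omega

theorem exists_natAbs_add_two_mul_lt (h : Odd (m + n)) (hn : n ≠ 0) :
    ∃ q : ℤ, (m + 2 * q * n).natAbs < n.natAbs := by
  obtain ⟨q, hq⟩ := exists_natAbs_add_two_mul_le m hn
  refine ⟨q, hq.lt_of_ne fun heq => ?_⟩
  rw [mul_assoc] at heq
  rw [Int.odd_iff] at h
  omega

theorem exists_odd_add_mul_sub_mul_eq_one (h : IsCoprime a b) :
    ∃ c d : ℤ, Odd (c + d) ∧ a * d - b * c = 1 := by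
  obtain ⟨d, c, hdc⟩ := h
  rcases Int.even_or_odd (-c + d) with heven | hodd
  · obtain ⟨k, hk⟩ := id heven
    have hmul : Odd (d * (a + b)) := ⟨k * b, by linear_combination hdc + b * hk⟩
    exact ⟨-c + a, d + b, by convert heven.add_odd (Int.odd_mul.1 hmul).2 using 1; ring,
      by linarith⟩
  · exact ⟨-c, d, hodd, by linarith⟩

theorem exists_odd_add_natAbs_lt_isUnit (h : IsCoprime a b) (hb : b ≠ 0) :
    ∃ c d : ℤ, Odd (c + d) ∧ d.natAbs < b.natAbs ∧ IsUnit (a * d - b * c) := by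
  by_cases hunit : IsUnit b
  · exact ⟨1, 0, by decide, by simpa using hb, by simpa using hunit⟩
  obtain ⟨c, d, hodd, hdet⟩ := exists_odd_add_mul_sub_mul_eq_one h
  obtain ⟨q, hq⟩ := exists_natAbs_add_two_mul_le d hb
  have hdet' : a * (d + 2 * q * b) - b * (c + 2 * q * a) = 1 := by linear_combination hdet
  refine ⟨c + 2 * q * a, d + 2 * q * b, ?_, hq.lt_of_ne fun heq => hunit ?_,
    hdet' ▸ isUnit_one⟩
  · convert hodd.add_even (even_two_mul (q * (a + b))) using 1
    ring
  · refine isUnit_of_dvd_one (hdet' ▸ dvd_sub (Dvd.dvd.mul_left ?_ a) (dvd_mul_right b _))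
    exact Int.natAbs_dvd_natAbs.1 heq.symm.dvd

end Arithmetic

section Height

variable {v x y z : Fin 3 → ℤ}

/-- The height of a vector of `ℤ³`, along which `𝒴` is filtered: the absolute value of its last
coordinate. -/
def height (v : Fin 3 → ℤ) : ℕ :=
  (v 2).natAbs

theorem exists_height_add_smul_lt (hz : Admissible z)
    (hzv : ∃ i, Odd (z i - v i)) (hpos : 0 < height v) :
    ∃ q : ℤ, Admissible (z + q • v) ∧ height (z + q • v) < height v := by
  have hv₂ : v 2 ≠ 0 := Int.natAbs_pos.1 hpos
  by_cases hodd : Odd (z 2 + v 2)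
  · obtain ⟨q, hq⟩ := exists_natAbs_add_two_mul_lt hodd hv₂
    exact ⟨2 * q, by rwa [mul_smul, admissible_add_two_smul_iff], hq⟩
  · obtain ⟨q, hq⟩ := exists_natAbs_add_mul_lt (z 2) hv₂
    refine ⟨q, ?_, hq⟩
    rcases Int.even_or_odd' q with ⟨k, rfl | rfl⟩
    · rwa [mul_smul, admissible_add_two_smul_iff]
    · obtain ⟨i, hi⟩ := hzv
      rw [add_smul, one_smul, mul_smul, add_comm _ v, ← add_assoc, admissible_add_two_smul_iff]
      refine admissible_of_even (Int.not_odd_iff_even.1 hodd) ⟨i, ?_⟩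
      rwa [Pi.add_apply, Int.odd_add, ← Int.odd_sub]

theorem singleton_apex_mem : {Pi.single 2 1} ∈ augmentedComplex.faces :=
  singleton_mem_faces ((admissible_single 2).pair_mem (admissible_single 0) (z := Pi.single 1 1)
    (by simp [tripleDet_eq])) (Finset.mem_insert_self _ _)

theorem cone_mem_augmentedComplex (h : {x, y} ∈ augmentedComplex.faces) (hx : height x = 0)
    (hy : height y = 0) : {Pi.single 2 1, x, y} ∈ augmentedComplex.faces := by
  obtain ⟨hface, hadm⟩ := mem_faces_augmentedComplex_iff.1 h
  have hadmx := hadm x (by simp)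
  have hadmy := hadm y (by simp)
  rw [height, Int.natAbs_eq_zero] at hx hy
  rcases eq_or_ne x y with rfl | hne
  · obtain ⟨p, q, hdet⟩ := exists_isUnit_tripleDet_of_mem_vertexSet
      (singleton_mem_faces hface (v := x) (by simp))
    have hdet_eq : tripleDet (Pi.single 2 1) x (q 2 • p - p 2 • q) = tripleDet x p q := by
      rw [← tripleDet_rotate, tripleDet_single_two, tripleDet_eq, hx]
      simp only [Pi.sub_apply, Pi.smul_apply, smul_eq_mul]
      ring
    simpa using (admissible_single 2).pair_mem hadmx (hdet_eq ▸ hdet)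
  · obtain ⟨z, hdet⟩ := exists_isUnit_tripleDet_of_pair_mem hface hne
    have hdet_eq : tripleDet x y z = z 2 * tripleDet (Pi.single 2 1) x y := by
      rw [← tripleDet_rotate (Pi.single 2 1), tripleDet_single_two, tripleDet_eq, hx, hy]
      ring
    rw [hdet_eq, IsUnit.mul_iff] at hdet
    exact (admissible_single 2).triple_mem hadmx hadmy hdet.2

theorem Admissible.odd_tripleDet_single (hx : Admissible x) (hy : Admissible y)
    (hparity : Odd (x 2) ↔ Odd (y 2)) (hdet : Odd (tripleDet x y z)) :
    Odd (tripleDet x y (Pi.single 2 1)) := by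
  have hexpand : tripleDet x y z = tripleDet x y (Pi.single 2 1) * z 2 +
      (x 1 * y 2 - x 2 * y 1) * z 0 + (x 2 * y 0 - x 0 * y 2) * z 1 := by
    rw [tripleDet_single_two, tripleDet_eq]
    ring
  rcases Int.even_or_odd (x 2) with hx₂ | hx₂
  · have hy₂ : Even (y 2) := by simpa only [← Int.not_odd_iff_even, hparity] using hx₂
    have heven : Even ((x 1 * y 2 - x 2 * y 1) * z 0 + (x 2 * y 0 - x 0 * y 2) * z 1) :=
      (((hy₂.mul_left _).sub (hx₂.mul_right _)).mul_right _).add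
        (((hx₂.mul_right _).sub (hy₂.mul_left _)).mul_right _)
    rw [hexpand, add_assoc, Int.odd_add, iff_true_right heven] at hdet
    exact (Int.odd_mul.1 hdet).1
  · obtain ⟨hx₀, hx₁⟩ := hx.1 hx₂
    obtain ⟨hy₀, hy₁⟩ := hy.1 (hparity.1 hx₂)
    refine absurd hdet (Int.not_odd_iff_even.2 ?_)
    rw [tripleDet_eq]
    exact ((hx₀.mul_right _).sub (hx₁.mul_right _)).add
      (((hy₀.mul_right _).sub (hy₁.mul_right _)).mul_left _)

theorem exists_lower_of_height_eq (h : {x, y} ∈ augmentedComplex.faces) (hne : x ≠ y)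
    (heq : height x = height y) (hpos : 0 < height x) :
    ∃ w, height w < height x ∧ {w, x, y} ∈ augmentedComplex.faces := by
  obtain ⟨hface, hadm⟩ := mem_faces_augmentedComplex_iff.1 h
  have hadmx := hadm x (by simp)
  have hadmy := hadm y (by simp)
  obtain ⟨t, hdet⟩ := exists_isUnit_tripleDet_of_pair_mem hface hne
  have hparity : Odd (x 2) ↔ Odd (y 2) := by
    rw [← Int.natAbs_odd, ← Int.natAbs_odd (n := y 2)]
    exact iff_of_eq (congrArg Odd heq)
  have hodd := hadmx.odd_tripleDet_single hadmy hparity (odd_of_isUnit hdet)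
  obtain ⟨s, hs⟩ := exists_isUnit_tripleDet_add_two_smul hdet hodd
  have hs' : IsUnit (tripleDet (Pi.single 2 1 + (2 : ℤ) • s) x y) := by
    rwa [← tripleDet_rotate]
  obtain ⟨q, hadmw, hlt⟩ := exists_height_add_smul_lt
    ((admissible_add_two_smul_iff _ s).2 (admissible_single 2))
    (exists_odd_sub_of_isUnit_tripleDet hs') hpos
  refine ⟨_, hlt, hadmw.triple_mem hadmx hadmy ?_⟩
  rwa [← tripleDet_rotate, tripleDet_add_smul_first]

end Height

section DescendingLink

variable {v y z : Fin 3 → ℤ}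
  {u w : {u : Fin 3 → ℤ // height u < height v ∧ {u, v} ∈ augmentedComplex.faces}}

theorem admissible_of_descendingLink (u : {u : Fin 3 → ℤ //
    height u < height v ∧ {u, v} ∈ augmentedComplex.faces}) : Admissible u.1 :=
  (mem_faces_augmentedComplex_iff.1 u.2.2).2 u.1 (by simp)

theorem adj_descendingLink (hv : Admissible v) (h : IsUnit (tripleDet v u.1 w.1)) :
    (descendingLink augmentedComplex height v).Adj u w := by
  have h' : IsUnit (tripleDet u.1 w.1 v) := by rwa [tripleDet_rotate]
  refine ⟨?_, (admissible_of_descendingLink u).triple_mem (admissible_of_descendingLink w) hv h'⟩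
  rintro rfl
  rw [show tripleDet v u.1 u.1 = 0 by rw [tripleDet_eq]; ring] at h
  exact not_isUnit_zero h

theorem exists_descendingLink_eq_add_smul (hv : Admissible v) (hz : Admissible z)
    (h : IsUnit (tripleDet v y z)) (hpos : 0 < height v) :
    ∃ (u : {u : Fin 3 → ℤ // height u < height v ∧ {u, v} ∈ augmentedComplex.faces}) (q : ℤ),
      u.1 = z + q • v := by
  have hzv : IsUnit (tripleDet z v y) := by rwa [← tripleDet_rotate]
  obtain ⟨q, hadm, hlt⟩ := exists_height_add_smul_lt hz
    (exists_odd_sub_of_isUnit_tripleDet hzv) hpos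
  have hdet : IsUnit (tripleDet (z + q • v) v y) := by
    rwa [← tripleDet_rotate, tripleDet_add_smul_first]
  exact ⟨⟨z + q • v, hlt, hadm.pair_mem hv hdet⟩, q, rfl⟩

theorem isCoprime_of_descendingLink {α a b : ℤ} (hu : u.1 = α • v + a • y + b • z)
    (h : IsUnit (tripleDet v y z)) : IsCoprime a b := by
  obtain ⟨t, ht⟩ := exists_isUnit_tripleDet_of_pair_mem
    (mem_faces_augmentedComplex_iff.1 u.2.2).1 (ne_of_apply_ne height u.2.1.ne)
  obtain ⟨β, c, d, rfl⟩ := exists_eq_smul_add_smul_add_smul h t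
  have hunit : IsUnit ((a * d - b * c) * tripleDet v y z) := by
    rwa [← tripleDet_comb v y z α a b β, ← hu, ← isUnit_tripleDet_swap]
  obtain ⟨e, he⟩ := (isUnit_of_mul_isUnit_left hunit).exists_left_inv
  exact ⟨e * d, -(e * c), by linear_combination he⟩

theorem reachable_descendingLink (hv : Admissible v) (hy : Admissible y) (hz : Admissible z)
    (hdet : IsUnit (tripleDet v y z)) (hpos : 0 < height v) {q : ℤ} (hw : w.1 = z + q • v)
    {α a b : ℤ} (hu : u.1 = α • v + a • y + b • z) :
    (descendingLink augmentedComplex height v).Reachable u w := by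
  induction hn : b.natAbs using Nat.strong_induction_on generalizing u α a b with
  | _ n ih =>
    have hcop := isCoprime_of_descendingLink hu hdet
    rcases eq_or_ne b 0 with rfl | hb
    · refine (adj_descendingLink hv ?_).reachable
      rw [hu, show w.1 = q • v + (0 : ℤ) • y + (1 : ℤ) • z by rw [hw]; module, tripleDet_comb]
      simpa using (isCoprime_zero_right.1 hcop).mul hdet
    obtain ⟨c, d, hodd, hlt, hunit⟩ := exists_odd_add_natAbs_lt_isUnit hcop hb
    have hunit' : IsUnit ((a * d - b * c) * tripleDet v y z) := hunit.mul hdet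
    rw [← tripleDet_comb v y z α a b 0, zero_smul, zero_add, ← hu] at hunit'
    obtain ⟨x, r, hx⟩ :=
      exists_descendingLink_eq_add_smul hv (hy.comb hz hodd) hunit' hpos
    refine (adj_descendingLink hv ?_).reachable.trans
      (ih d.natAbs (hn ▸ hlt) (u := x) (α := r) (a := c) (b := d) (by rw [hx]; module) rfl)
    rwa [hx, tripleDet_add_smul_first]

theorem connected_descendingLink (hv : {v} ∈ augmentedComplex.faces) (hpos : 0 < height v) :
    (descendingLink augmentedComplex height v).Connected := by
  obtain ⟨hface, hadm⟩ := mem_faces_augmentedComplex_iff.1 hv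
  have hadmv := hadm v (by simp)
  obtain ⟨y, z, hy, hz, hdet⟩ := hadmv.exists_completion hface
  obtain ⟨w, q, hw⟩ := exists_descendingLink_eq_add_smul hadmv hz hdet hpos
  refine SimpleGraph.connected_iff_exists_forall_reachable _ |>.2 ⟨w, fun u => ?_⟩
  obtain ⟨α, a, b, hu⟩ := exists_eq_smul_add_smul_add_smul hdet u.1
  exact (reachable_descendingLink hadmv hy hz hdet hpos hw hu).symm

end DescendingLink

end PalindromicComplex

theorem mainTheorem9 :
    SimplyConnectedSpace PalindromicComplex.augmentedComplex.Realization :=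
  SimplicialRealization.simplyConnectedSpace_of_height (f := PalindromicComplex.height)
    (x₀ := ⟨Pi.single 2 1, PalindromicComplex.singleton_apex_mem⟩)
    (fun _ _ => PalindromicComplex.cone_mem_augmentedComplex)
    (fun _ => PalindromicComplex.connected_descendingLink)
    (fun _ _ => PalindromicComplex.exists_lower_of_height_eq)
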